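/- Let $d,m$ be natural numbers, $t_0<T$, and let $a:[t_0,T]\times\mathbb R^d\to\mathbb R^d$ and $\sigma_r:[t_0,T]\times\mathbb R^d\to\mathbb R^d$ ($r=1,\dots,m$) be coefficients such that $\sup_{t\in[t_0,T]}|a(t,0)|<\infty$, each $\sigma_r(t,\cdot)$ is continuously differentiable, and there are constants $c_1,c_2,L_1,L_2\ge 0$ and $\varkappa\ge 1$ with, for all $t\in[t_0,T]$, $x,y\in\mathbb R^d$ and $r=1,\dots,m$, $$(x-y,a(t,x)-a(t,y))\le c_1|x-y|^2,\qquad |a(t,x)-a(t,y)|^2\le c_2\bigl(1+|x|^{2\varkappa-2}+|y|^{2\varkappa-2}\bigr)|x-y|^2,$$ $$|\nabla\sigma_r(t,x)|\le L_1,\qquad |\nabla\sigma_r(t,x)\sigma_r(t,x)-\nabla\sigma_r(t,y)\sigma_r(t,y)|\le L_2|x-y|,$$ where $\nabla\sigma_r$ is the Jacobian matrix in $x$ and $|\nabla\sigma_r|$ its operator norm. Assume in addition that the $\sigma_r$ are uniformly bounded on $[t_0,T]\times\mathbb R^d$. Let $l\ge 1$, $0<\varepsilon<1$, and let $h_0>0$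 be such that for all $0<h\le h_0$ $$\tfrac12\Bigl[hc_1+\tfrac m2L_2h+mL_1\sqrt{2lh|\ln h|}\Bigr]\le 1-\varepsilon .$$ For $N\ge1$ put $h=(T-t_0)/N$, $t_{k+1/2}=t_0+(k+\tfrac12)h$, and consider the mid-point scheme $$X_{k+1}=X_k+a(t_{k+1/2},U_{k+1})h-\tfrac12\sum_{r=1}^m\nabla\sigma_r(t_{k+1/2},U_{k+1})\,\sigma_r(t_{k+1/2},U_{k+1})h+\sum_{r=1}^m\sigma_r(t_{k+1/2},U_{k+1})(\zeta_{rh})_k\sqrt h,$$ $$U_{k+1}=\tfrac12(X_k+X_{k+1}),\qquad k=0,\dots,N-1,$$ where $(\zeta_{rh})_k=\max(-A_h,\min(A_h,\xi_{r,k}))$, $A_h=\sqrt{2l|\ln h|}$, the $\xi_{r,k}$ are i.i.d. standard Gaussian random variables, and the initial value $X_0$ is independent of all the $\xi_{r,k}$ and satisfies $\mathbb E|X_0|^{2q}<\infty$ for every $q\ge1$. Then for every real $p\ge1$ there is a constant $K>0$, which depends neither on $N$ (that is, on $h$), nor on $k$, nor on the probability space and the random variables $X_0,\xi_{r,k}$,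 such that whenever $h=(T-t_0)/N\le h_0$, for every solution $(X_k)$ of the scheme and all $k=0,\dots,N$ the moment $\mathbb E|X_k|^{2p}$ is finite and $$\mathbb E|X_k|^{2p}\le K\bigl(1+\mathbb E|X_0|^{4(p+1)\varkappa-4}\bigr)^{1/2}.$$ -/

import Mathlib

open MeasureTheory ProbabilityTheory

noncomputable section

namespace MidPoint

/-- The state space `ℝ^d` with its Euclidean norm. -/
abbrev E (d : ℕ) : Type := EuclideanSpace ℝ (Fin d)

/-- The vector `∇σ(x) σ(x) = ∑ⱼ (∂σ/∂xʲ)(x) σʲ(x)` of a vector field `σ`: the derivative of `σ` at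
`x` in the direction `σ(x)`. -/
def gradMul {d : ℕ} (σ : E d → E d) (x : E d) : E d :=
  fderiv ℝ σ x (σ x)

/-- The assumption on the coefficients: drift `a(t, x)`, diffusion vectors `σ r (t, x)`,
`r = 1, …, m`, on the time interval `[t₀, T]`. The norm of `∇σ` is the operator norm. -/
structure CoeffAssumption {d m : ℕ} (t₀ T : ℝ) (a : ℝ → E d → E d) (σ : Fin m → ℝ → E d → E d)
    (c₁ c₂ ϰ L₁ L₂ : ℝ) : Prop where
  c₁_nonneg : 0 ≤ c₁
  c₂_nonneg : 0 ≤ c₂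
  one_le_ϰ : 1 ≤ ϰ
  L₁_nonneg : 0 ≤ L₁
  L₂_nonneg : 0 ≤ L₂
  /-- The drift at the origin is bounded in time (automatic if `a` is continuous in `t`). -/
  drift_zero_bdd : ∃ C : ℝ, ∀ t ∈ Set.Icc t₀ T, ‖a t 0‖ ≤ C
  one_sided_lipschitz : ∀ t ∈ Set.Icc t₀ T, ∀ x y : E d,
    inner ℝ (x - y) (a t x - a t y) ≤ c₁ * ‖x - y‖ ^ 2
  local_lipschitz : ∀ t ∈ Set.Icc t₀ T, ∀ x y : E d,
    ‖a t x - a t y‖ ^ 2 ≤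
      c₂ * (1 + ‖x‖ ^ (2 * ϰ - 2) + ‖y‖ ^ (2 * ϰ - 2)) * ‖x - y‖ ^ 2
  contDiff : ∀ r, ∀ t ∈ Set.Icc t₀ T, ContDiff ℝ 1 (σ r t)
  grad_bdd : ∀ r, ∀ t ∈ Set.Icc t₀ T, ∀ x : E d, ‖fderiv ℝ (σ r t) x‖ ≤ L₁
  gradMul_lipschitz : ∀ r, ∀ t ∈ Set.Icc t₀ T, ∀ x y : E d,
    ‖gradMul (σ r t) x - gradMul (σ r t) y‖ ≤ L₂ * ‖x - y‖

/-- The truncation level `A_h = √(2 l |ln h|)`. -/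
def truncLevel (l h : ℝ) : ℝ := Real.sqrt (2 * l * |Real.log h|)

/-- The truncated variable `ζ_h`, as a function of the value of `ξ`. -/
def zeta (l h ξ : ℝ) : ℝ :=
  if truncLevel l h < ξ then truncLevel l h
  else if ξ < -truncLevel l h then -truncLevel l h
  else ξ

/-- The quantity `lam [h c₁ + m lam L₂ h + m L₁ √(2 l h |ln h|)]` that controls the step size. -/
def stepFactor (m : ℕ) (lam l c₁ L₁ L₂ h : ℝ) : ℝ :=
  lam * (h * c₁ + m * lam * L₂ * h + m * L₁ * Real.sqrt (2 * l * h * |Real.log h|))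

/-- `y` solves the equation of one step, from time `t` and point `x`, with step size `h` and noise
values `z r` (`r = 1, …, m`), of the fully implicit method with parameter `lam`. -/
def IsStep {d m : ℕ} (lam : ℝ) (a : ℝ → E d → E d) (σ : Fin m → ℝ → E d → E d)
    (h t : ℝ) (z : Fin m → ℝ) (x y : E d) : Prop :=
  y = x + h • a (t + lam * h) ((1 - lam) • x + lam • y)
    - (lam * h) • ∑ r, gradMul (σ r (t + lam * h)) ((1 - lam) • x + lam • y)
    + ∑ r, (z r * Real.sqrt h) • σ r (t + lam * h) ((1 - lam) • x + lam • y)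

/-- `X 0, …, X N` is an approximation produced by the fully implicit method with parameter `lam`
and step `h = (T - t₀) / N`, started from the random variable `X 0` and driven by the truncations
of the i.i.d. standard Gaussian variables `ξ k r`, which are independent of `X 0`. -/
structure IsScheme {d m : ℕ} {Ω : Type*} [MeasurableSpace Ω] (P : Measure Ω)
    (lam l t₀ T : ℝ) (a : ℝ → E d → E d) (σ : Fin m → ℝ → E d → E d) (N : ℕ)
    (ξ : Fin N → Fin m → Ω → ℝ) (X : ℕ → Ω → E d) : Prop where
  measurable_initial : Measurable (X 0)
  measurable_noise : ∀ k r, Measurable (ξ k r)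
  gaussian : ∀ k r, P.map (ξ k r) = gaussianReal 0 1
  iIndep : iIndepFun (fun i : Fin N × Fin m => ξ i.1 i.2) P
  indep_initial : IndepFun (X 0) (fun ω (i : Fin N × Fin m) => ξ i.1 i.2 ω) P
  step : ∀ k : Fin N, ∀ᵐ ω ∂P,
    IsStep lam a σ ((T - t₀) / N) (t₀ + (k : ℕ) * ((T - t₀) / N))
      (fun r => zeta l ((T - t₀) / N) (ξ k r ω)) (X k ω) (X (k + 1) ω)

end MidPoint

end

/-! Write `u` for the mid-point of a step from `x` to `y`. Since `‖y‖² - ‖x‖² = (y - x, y + x) = 2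
(u, y - x)`, the energy balance contains the increment only linearly, evaluated at `u`. No square of
the superlinear drift appears, and the one-sided Lipschitz condition controls `(u, a(u))`.

The difficulty is the noise term `w r (u, σ r (u))`, because `u` depends on `w`. The step-size
condition makes the implicit equation strongly monotone (`implicit_stability`). Hence `u` is unique
and is a Lipschitz function `f (x, w)`, with a constant free of the step size
(`exists_midpoint_map`). Replacing `u` by the noise-free `f (x, 0)` leaves a term linear in `w` with
a coefficient depending on `x` alone; the error is of order `∑ (w r)²` (`one_add_norm_sq_step_le`).
A second-order expansion carries this form over to the `p`-th power (`exists_step_bound`).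

Uniqueness also makes `X k` a function of the initial value and the past noise, so it is independent
of the current noise. In expectation the linear term vanishes by symmetry and the quadratic one is
at most of order `h` (`integral_step_le`). Iteration gives a factor `exp (C (1 + m) (T - t₀))`, and
Cauchy–Schwarz bounds the initial moment in the stated form. -/

namespace MidPoint

/-! ### One step as an implicit equation, and its monotonicity. -/

/-- The increment of the mid-point method with step size `h` and scaled noise `w r = z r √h`, when
the coefficients are evaluated at time `s` and at the mid-point `u`. -/
noncomputable def midIncr {d m : ℕ} (a : ℝ → E d → E d) (σ : Fin m → ℝ → E d → E d) (h s : ℝ)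
    (w : Fin m → ℝ) (u : E d) : E d :=
  h • a s u - (h / 2) • ∑ r, gradMul (σ r s) u + ∑ r, w r • σ r s u

lemma IsStep.eq_add_midIncr {d m : ℕ} {a : ℝ → E d → E d} {σ : Fin m → ℝ → E d → E d}
    {h t : ℝ} {z : Fin m → ℝ} {x y : E d} (H : IsStep (1 / 2) a σ h t z x y) :
    y = x + midIncr a σ h (t + 1 / 2 * h) (fun r => z r * √h) ((1 / 2 : ℝ) • (x + y)) := by
  unfold IsStep at H
  have e : (1 - (1 / 2 : ℝ)) • x + (1 / 2 : ℝ) • y = (1 / 2 : ℝ) • (x + y) := by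
    rw [smul_add]; norm_num
  rw [e] at H
  conv_lhs => rw [H]
  rw [midIncr, show h / 2 = 1 / 2 * h by ring]
  abel

namespace CoeffAssumption

variable {d m : ℕ} {t₀ T : ℝ} {a : ℝ → E d → E d} {σ : Fin m → ℝ → E d → E d}
  {c₁ c₂ ϰ L₁ L₂ : ℝ}

lemma norm_sigma_sub_le (H : CoeffAssumption t₀ T a σ c₁ c₂ ϰ L₁ L₂) (r : Fin m) {s : ℝ}
    (hs : s ∈ Set.Icc t₀ T) (u v : E d) : ‖σ r s u - σ r s v‖ ≤ L₁ * ‖u - v‖ :=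
  Convex.norm_image_sub_le_of_norm_fderiv_le (𝕜 := ℝ)
    (fun x _ => ((H.contDiff r s hs).differentiable (by norm_num)) x)
    (fun x _ => H.grad_bdd r s hs x) convex_univ (Set.mem_univ v) (Set.mem_univ u)

lemma norm_gradMul_le (H : CoeffAssumption t₀ T a σ c₁ c₂ ϰ L₁ L₂) {B : ℝ}
    (hB : ∀ r, ∀ t ∈ Set.Icc t₀ T, ∀ x, ‖σ r t x‖ ≤ B) (r : Fin m) {s : ℝ}
    (hs : s ∈ Set.Icc t₀ T) (u : E d) : ‖gradMul (σ r s) u‖ ≤ L₁ * B :=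
  (ContinuousLinearMap.le_opNorm _ _).trans
    (mul_le_mul (H.grad_bdd r s hs u) (hB r s hs u) (norm_nonneg _) H.L₁_nonneg)

lemma norm_sum_gradMul_le (H : CoeffAssumption t₀ T a σ c₁ c₂ ϰ L₁ L₂) {B : ℝ}
    (hB : ∀ r, ∀ t ∈ Set.Icc t₀ T, ∀ x, ‖σ r t x‖ ≤ B) {s : ℝ}
    (hs : s ∈ Set.Icc t₀ T) (u : E d) : ‖∑ r, gradMul (σ r s) u‖ ≤ m * (L₁ * B) := by
  refine (norm_sum_le_of_le _ fun r _ => H.norm_gradMul_le hB r hs u).trans ?_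
  simp

lemma inner_midIncr_sub_le (H : CoeffAssumption t₀ T a σ c₁ c₂ ϰ L₁ L₂) {B : ℝ}
    (hB : ∀ r, ∀ t ∈ Set.Icc t₀ T, ∀ x, ‖σ r t x‖ ≤ B) {h s ρ : ℝ} (hh : 0 ≤ h)
    (hs : s ∈ Set.Icc t₀ T) {w w' : Fin m → ℝ} (hw : ∀ r, |w r| ≤ ρ) (u v : E d) :
    inner ℝ (u - v) (midIncr a σ h s w u - midIncr a σ h s w' v) ≤
      (h * c₁ + m * (1 / 2) * L₂ * h + m * L₁ * ρ) * ‖u - v‖ ^ 2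
        + B * (∑ r, |w r - w' r|) * ‖u - v‖ := by
  -- The noise difference is split so that `w` multiplies `σ(u) - σ(v)`, and `w - w'` multiplies the
  -- bounded `σ(v)`. Only `w` then needs the bound `ρ`.
  have e : midIncr a σ h s w u - midIncr a σ h s w' v = h • (a s u - a s v)
      - (h / 2) • ∑ r, (gradMul (σ r s) u - gradMul (σ r s) v)
      + (∑ r, w r • (σ r s u - σ r s v) + ∑ r, (w r - w' r) • σ r s v) := by
    simp only [midIncr, Finset.sum_sub_distrib, smul_sub, sub_smul]
    abel
  rw [e, inner_add_right, inner_sub_right, inner_add_right, inner_smul_right, inner_smul_right]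
  have n0 := norm_nonneg (u - v)
  have h1 := mul_le_mul_of_nonneg_left (H.one_sided_lipschitz s hs u v) hh
  have h2 : -(inner ℝ (u - v) (∑ r, (gradMul (σ r s) u - gradMul (σ r s) v)))
      ≤ ‖u - v‖ * (m * (L₂ * ‖u - v‖)) := by
    rw [← inner_neg_right]
    refine (real_inner_le_norm _ _).trans (mul_le_mul_of_nonneg_left ?_ n0)
    rw [norm_neg]
    refine (norm_sum_le_of_le _ fun r _ => H.gradMul_lipschitz r s hs u v).trans ?_
    simp
  have h3 : inner ℝ (u - v) (∑ r, w r • (σ r s u - σ r s v))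
      ≤ ‖u - v‖ * (m * (ρ * (L₁ * ‖u - v‖))) := by
    refine (real_inner_le_norm _ _).trans (mul_le_mul_of_nonneg_left ?_ n0)
    refine (norm_sum_le_of_le _ (f := fun r => w r • (σ r s u - σ r s v))
      (n := fun _ => ρ * (L₁ * ‖u - v‖)) fun r _ => ?_).trans ?_
    · rw [norm_smul, Real.norm_eq_abs]
      exact mul_le_mul (hw r) (H.norm_sigma_sub_le r hs u v) (norm_nonneg _)
        ((abs_nonneg _).trans (hw r))
    · simp
  have h4 : inner ℝ (u - v) (∑ r, (w r - w' r) • σ r s v)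
      ≤ ‖u - v‖ * ((∑ r, |w r - w' r|) * B) := by
    refine (real_inner_le_norm _ _).trans (mul_le_mul_of_nonneg_left ?_ n0)
    rw [Finset.sum_mul]
    refine norm_sum_le_of_le _ fun r _ => ?_
    rw [norm_smul, Real.norm_eq_abs]
    exact mul_le_mul_of_nonneg_left (hB r s hs v) (abs_nonneg _)
  have h5 := mul_le_mul_of_nonneg_left h2 (by positivity : 0 ≤ h / 2)
  linarith

/-- Strong monotonicity of the implicit equation. -/
lemma implicit_stability (H : CoeffAssumption t₀ T a σ c₁ c₂ ϰ L₁ L₂) {B : ℝ}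
    (hB : ∀ r, ∀ t ∈ Set.Icc t₀ T, ∀ x, ‖σ r t x‖ ≤ B) {h s ρ ε : ℝ} (hh : 0 ≤ h)
    (hs : s ∈ Set.Icc t₀ T)
    (hstep : 1 / 2 * (h * c₁ + m * (1 / 2) * L₂ * h + m * L₁ * ρ) ≤ 1 - ε)
    {w w' : Fin m → ℝ} (hw : ∀ r, |w r| ≤ ρ) {x x' u v : E d}
    (hu : u = x + (1 / 2 : ℝ) • midIncr a σ h s w u)
    (hv : v = x' + (1 / 2 : ℝ) • midIncr a σ h s w' v) :
    ε * ‖u - v‖ ≤ ‖x - x'‖ + 1 / 2 * B * ∑ r, |w r - w' r| := by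
  have key := H.inner_midIncr_sub_le hB (w' := w') hh hs hw u v
  have e : u - v = (x - x') + (1 / 2 : ℝ) • (midIncr a σ h s w u - midIncr a σ h s w' v) := by
    conv_lhs => rw [hu, hv]
    rw [smul_sub]
    abel
  have e2 : ‖u - v‖ ^ 2 = inner ℝ (u - v) (x - x') + 1 / 2 *
      inner ℝ (u - v) (midIncr a σ h s w u - midIncr a σ h s w' v) := by
    rw [← inner_smul_right, ← inner_add_right, ← e, real_inner_self_eq_norm_sq]
  have h1 := real_inner_le_norm (u - v) (x - x')
  -- If `u = v`, only the sign of `B` matters: it follows from any value of `σ` when `m > 0`, and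
  -- the sum is empty otherwise. If not, divide by `‖u - v‖`.
  rcases (norm_nonneg (u - v)).eq_or_lt with h0 | h0
  · rcases isEmpty_or_nonempty (Fin m) with hm | ⟨⟨r⟩⟩
    · rw [← h0]; simp
    · have hB0 : 0 ≤ B := (norm_nonneg _).trans (hB r s hs u)
      rw [← h0, mul_zero]; positivity
  · have := mul_le_mul_of_nonneg_right hstep (sq_nonneg ‖u - v‖)
    refine le_of_mul_le_mul_right ?_ h0
    linarith

end CoeffAssumption

/-! ### Truncated noise and scalar inequalities. -/

lemma sqrt_mul_truncLevel (l : ℝ) {h : ℝ} (hh : 0 ≤ h) :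
    √h * truncLevel l h = √(2 * l * h * |Real.log h|) := by
  rw [truncLevel, ← Real.sqrt_mul hh]
  ring_nf

/-- Apply `log x ≤ x - 1` to `h` or to `h⁻¹`, according to the sign of the logarithm. This makes the
bound on the scaled noise uniform in `h`. -/
lemma mul_abs_log_le {h τ : ℝ} (hh : 0 < h) (hτ : h ≤ τ) : h * |Real.log h| ≤ 1 + τ ^ 2 := by
  rcases abs_cases (Real.log h) with ⟨e, _⟩ | ⟨e, _⟩
  · rw [e]
    have := Real.log_le_sub_one_of_pos hh
    nlinarith
  · rw [e, ← Real.log_inv]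
    have := mul_le_mul_of_nonneg_left (Real.log_le_sub_one_of_pos (inv_pos.2 hh)) hh.le
    rw [mul_sub, mul_inv_cancel₀ hh.ne'] at this
    nlinarith

lemma sqrt_mul_abs_log_le {l h τ : ℝ} (hl : 0 ≤ l) (hh : 0 < h) (hτ : h ≤ τ) :
    √(2 * l * h * |Real.log h|) ≤ √(2 * l * (1 + τ ^ 2)) := by
  apply Real.sqrt_le_sqrt
  have := mul_le_mul_of_nonneg_left (mul_abs_log_le hh hτ) (by positivity : 0 ≤ 2 * l)
  linarith

lemma abs_zeta_le (l h ξ : ℝ) : |zeta l h ξ| ≤ truncLevel l h := by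
  have : 0 ≤ truncLevel l h := Real.sqrt_nonneg _
  unfold zeta
  split_ifs <;> rw [abs_le] <;> constructor <;> linarith

lemma abs_zeta_le_abs (l h ξ : ℝ) : |zeta l h ξ| ≤ |ξ| := by
  have : 0 ≤ truncLevel l h := Real.sqrt_nonneg _
  unfold zeta
  split_ifs with h1 h2
  · rw [abs_of_nonneg this]; exact h1.le.trans (le_abs_self _)
  · rw [abs_neg, abs_of_nonneg this]; linarith [neg_le_abs ξ]
  · exact le_rfl

lemma zeta_neg (l h ξ : ℝ) : zeta l h (-ξ) = -zeta l h ξ := by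
  have : 0 ≤ truncLevel l h := Real.sqrt_nonneg _
  unfold zeta
  split_ifs <;> linarith

lemma measurable_zeta (l h : ℝ) : Measurable (zeta l h) :=
  Measurable.ite (measurableSet_lt measurable_const measurable_id) measurable_const
    (Measurable.ite (measurableSet_lt measurable_id measurable_const) measurable_const
      measurable_id)

/-- A second-order bound of a power near `1`, obtained from the Taylor bound of `exp`. -/
lemma one_add_rpow_le {x p R : ℝ} (hp : 0 ≤ p) (hx : 0 ≤ 1 + x) (hR : |x| ≤ R) :
    (1 + x) ^ p ≤ 1 + p * x + p ^ 2 * Real.exp (p * R) * x ^ 2 := by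
  have h1 : (1 + x) ^ p ≤ Real.exp (p * x) := by
    rw [mul_comm, Real.exp_mul]
    exact Real.rpow_le_rpow hx (by linarith [Real.add_one_le_exp x]) hp
  have h2 : |Real.exp (p * x) - (1 + p * x)| ≤ |p * x| ^ 2 * Real.exp |p * x| := by
    have := Complex.norm_exp_sub_sum_le_norm_mul_exp ((p * x : ℝ) : ℂ) 2
    rw [Complex.norm_real, Real.norm_eq_abs] at this
    refine le_trans (le_of_eq ?_) this
    rw [← Real.norm_eq_abs, ← Complex.norm_real]
    congr 1
    simp [Finset.sum_range_succ]
  rw [abs_mul, mul_pow, sq_abs, sq_abs] at h2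
  have h3 := (abs_le.1 h2).2
  have h4 : Real.exp (|p| * |x|) ≤ Real.exp (p * R) := by
    rw [abs_of_nonneg hp]
    exact Real.exp_le_exp.2 (mul_le_mul_of_nonneg_left hR hp)
  have h5 := mul_le_mul_of_nonneg_left h4 (by positivity : 0 ≤ p ^ 2 * x ^ 2)
  linarith

end MidPoint

/-! ### The mid-point as a Lipschitz function of the starting point and the noise. -/

namespace MidPoint

/-- The order of quantifiers is the point: the constant depends on neither the map nor the set, so
later bounds are uniform in the step size and the time. -/
lemma exists_lipschitz_extension {α F : Type*} [PseudoMetricSpace α] [NormedAddCommGroup F]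
    [NormedSpace ℝ F] [FiniteDimensional ℝ F] (K : NNReal) :
    ∃ C : NNReal, ∀ (f : α → F) (S : Set α), LipschitzOnWith K f S →
      ∃ g : α → F, LipschitzWith C g ∧ Set.EqOn f g S :=
  ⟨_, fun _ _ hf => hf.extend_finite_dimension⟩

namespace CoeffAssumption

variable {d m : ℕ} {t₀ T : ℝ} {a : ℝ → E d → E d} {σ : Fin m → ℝ → E d → E d}
  {c₁ c₂ ϰ L₁ L₂ : ℝ}

/-- The mid-point is the value of a globally Lipschitz map of the starting point and the noise. -/
lemma exists_midpoint_map (H : CoeffAssumption t₀ T a σ c₁ c₂ ϰ L₁ L₂) {B ε : ℝ}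
    (hB0 : 0 ≤ B) (hB : ∀ r, ∀ t ∈ Set.Icc t₀ T, ∀ x, ‖σ r t x‖ ≤ B) (hε : 0 < ε) :
    ∃ C : NNReal, ∀ h s ρ : ℝ, 0 ≤ h → s ∈ Set.Icc t₀ T →
      1 / 2 * (h * c₁ + m * (1 / 2) * L₂ * h + m * L₁ * ρ) ≤ 1 - ε →
      ∃ f : E d × (Fin m → ℝ) → E d, LipschitzWith C f ∧
        ∀ (x : E d) (w : Fin m → ℝ) (u : E d), (∀ r, |w r| ≤ ρ) →
          u = x + (1 / 2 : ℝ) • midIncr a σ h s w u → f (x, w) = u := by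
  obtain ⟨C, hC⟩ := exists_lipschitz_extension (α := E d × (Fin m → ℝ)) (F := E d)
    (Real.toNNReal ((1 + 1 / 2 * B * m) / ε))
  refine ⟨C, fun h s ρ hh hs hstep => ?_⟩
  -- `S` holds the data for which the equation is solvable. Extending the solution map from `S`
  -- avoids proving solvability and gives measurability for free.
  obtain ⟨S, hS⟩ : ∃ S : Set (E d × (Fin m → ℝ)), ∀ q, q ∈ S ↔
      (∀ r, |q.2 r| ≤ ρ) ∧ ∃ u, u = q.1 + (1 / 2 : ℝ) • midIncr a σ h s q.2 u :=
    ⟨{q | _}, fun _ => Iff.rfl⟩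
  have hsol : ∀ q : E d × (Fin m → ℝ), ∃ u, q ∈ S →
      u = q.1 + (1 / 2 : ℝ) • midIncr a σ h s q.2 u := by
    intro q
    by_cases hq : q ∈ S
    · exact ⟨((hS q).1 hq).2.choose, fun _ => ((hS q).1 hq).2.choose_spec⟩
    · exact ⟨0, fun h => absurd h hq⟩
  choose f₀ hf₀ using hsol
  have hlip : LipschitzOnWith (Real.toNNReal ((1 + 1 / 2 * B * m) / ε)) f₀ S := by
    refine LipschitzOnWith.of_dist_le_mul fun q hq q' hq' => ?_
    have h1 := H.implicit_stability hB hh hs hstep ((hS q).1 hq).1 (hf₀ q hq) (hf₀ q' hq')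
    have h2 : ‖q.1 - q'.1‖ ≤ dist q q' := by
      rw [← dist_eq_norm]; exact le_max_left _ _
    have h3 : ∑ r, |q.2 r - q'.2 r| ≤ m * dist q q' := by
      refine (Finset.sum_le_card_nsmul _ _ (dist q q') fun r _ => ?_).trans (by simp)
      rw [← Real.dist_eq]
      exact (dist_le_pi_dist q.2 q'.2 r).trans (le_max_right _ _)
    rw [Real.coe_toNNReal _ (by positivity), dist_eq_norm, div_mul_eq_mul_div, le_div_iff₀ hε]
    have h4 := mul_le_mul_of_nonneg_left h3 (by positivity : 0 ≤ 1 / 2 * B)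
    linarith
  obtain ⟨f, hf, hfS⟩ := hC f₀ S hlip
  refine ⟨f, hf, fun x w u hw hu => ?_⟩
  have hq : (x, w) ∈ S := (hS _).2 ⟨hw, u, hu⟩
  -- Stability with equal data is uniqueness, so the chosen solution is the given `u`.
  have h1 := H.implicit_stability hB hh hs hstep hw (hf₀ (x, w) hq) hu
  have h2 : ‖f₀ (x, w) - u‖ ≤ 0 := by
    refine nonpos_of_mul_nonpos_right (h1.trans ?_) hε
    simp
  exact (hfS hq).symm.trans (sub_eq_zero.1 (norm_le_zero_iff.1 h2))

/-- A Lipschitz map grows linearly once it is controlled at one point. The reference point is the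
bounded datum `b` whose mid-point is `0`, so the drift is needed only at the origin. -/
lemma midpoint_map_growth (H : CoeffAssumption t₀ T a σ c₁ c₂ ϰ L₁ L₂) {B A : ℝ}
    (hB0 : 0 ≤ B) (hB : ∀ r, ∀ t ∈ Set.Icc t₀ T, ∀ x, ‖σ r t x‖ ≤ B)
    (hA : ∀ t ∈ Set.Icc t₀ T, ‖a t 0‖ ≤ A) {C : NNReal} {h s ρ τ D : ℝ} (hh : 0 ≤ h) (hτ : h ≤ τ)
    (hs : s ∈ Set.Icc t₀ T) (hρ : 0 ≤ ρ) (hD : 0 ≤ D)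
    {f : E d × (Fin m → ℝ) → E d} (hf : LipschitzWith C f)
    (hfS : ∀ (x : E d) (w : Fin m → ℝ) (u : E d), (∀ r, |w r| ≤ ρ) →
      u = x + (1 / 2 : ℝ) • midIncr a σ h s w u → f (x, w) = u)
    (x : E d) (w : Fin m → ℝ) (hw : ∀ r, |w r| ≤ D) :
    ‖f (x, w)‖ ≤ C * (1 + (τ * A + τ * (m * (L₁ * B))) + D) * (1 + ‖x‖) := by
  have hA0 : 0 ≤ A := (norm_nonneg _).trans (hA s hs)
  have hL := H.L₁_nonneg
  set b : E d := -((1 / 2 : ℝ) • midIncr a σ h s 0 0) with hb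
  set G := τ * A + τ * (m * (L₁ * B)) with hG
  have hG0 : 0 ≤ G := by
    have : 0 ≤ τ := hh.trans hτ
    positivity
  have h0 : f (b, 0) = 0 := hfS b 0 0 (by simpa using fun _ => hρ) (by simp [hb])
  have hbG : ‖b‖ ≤ G := by
    rw [hb, norm_neg, norm_smul]
    have h1 : ‖midIncr a σ h s 0 0‖ ≤ τ * A + τ / 2 * (m * (L₁ * B)) := by
      rw [midIncr]
      simp only [Pi.zero_apply, zero_smul, Finset.sum_const_zero, add_zero]
      refine (norm_sub_le _ _).trans (add_le_add ?_ ?_)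
      · rw [norm_smul, Real.norm_of_nonneg hh]
        exact mul_le_mul hτ (hA s hs) (norm_nonneg _) (hh.trans hτ)
      · rw [norm_smul, Real.norm_of_nonneg (by positivity)]
        exact mul_le_mul (by linarith) (H.norm_sum_gradMul_le hB hs 0) (norm_nonneg _)
          (by linarith)
    have h2 : 0 ≤ τ * A := mul_nonneg (hh.trans hτ) hA0
    have h3 : 0 ≤ τ * (m * (L₁ * B)) := mul_nonneg (hh.trans hτ) (by positivity)
    norm_num
    linarith
  have h1 : ‖f (x, w)‖ ≤ C * (‖x‖ + G + D) := by
    have h2 := hf.dist_le_mul (x, w) (b, 0)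
    rw [h0, dist_zero_right] at h2
    refine h2.trans (mul_le_mul_of_nonneg_left ?_ C.coe_nonneg)
    refine max_le ?_ ?_
    · rw [dist_eq_norm]
      have := norm_sub_le x b
      change ‖x - b‖ ≤ _
      linarith
    · change dist w 0 ≤ _
      rw [dist_zero_right]
      refine ((pi_norm_le_iff_of_nonneg hD).2 hw).trans ?_
      linarith [norm_nonneg x]
  refine h1.trans ?_
  rw [mul_assoc]
  refine mul_le_mul_of_nonneg_left ?_ C.coe_nonneg
  have := norm_nonneg x
  have h3 : 0 ≤ (G + D) * ‖x‖ := by positivity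
  linarith

/-! ### Energy estimate for one step and its powers. -/

/-- Energy estimate for one step. The noise term is evaluated at a point `v` near the mid-point. -/
lemma one_add_norm_sq_step_le (H : CoeffAssumption t₀ T a σ c₁ c₂ ϰ L₁ L₂) {B A : ℝ}
    (hB0 : 0 ≤ B) (hB : ∀ r, ∀ t ∈ Set.Icc t₀ T, ∀ x, ‖σ r t x‖ ≤ B)
    (hA : ∀ t ∈ Set.Icc t₀ T, ‖a t 0‖ ≤ A) {h s G C : ℝ} (hh : 0 ≤ h)
    (hs : s ∈ Set.Icc t₀ T) (hG : 0 ≤ G) (hC : 0 ≤ C) {w : Fin m → ℝ} {x y u v : E d}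
    (hy : y = x + midIncr a σ h s w u) (hu : u = (1 / 2 : ℝ) • (x + y))
    (hun : ‖u‖ ≤ G * (1 + ‖x‖)) (hvn : ‖v‖ ≤ G * (1 + ‖x‖))
    (huv : ‖u - v‖ ≤ C * ∑ r, |w r|) :
    1 + ‖y‖ ^ 2 ≤ (1 + ‖x‖ ^ 2) *
      (1 + (4 * (c₁ * G ^ 2 + A * G) + 2 * m * (L₁ * B) * G) * h
        + 4 * (B + L₁ * G) * C * m * ∑ r, w r ^ 2
        + ∑ r, w r * (2 * inner ℝ v (σ r s v) / (1 + ‖x‖ ^ 2))) := by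
  have hA0 : 0 ≤ A := (norm_nonneg _).trans (hA s hs)
  have hL := H.L₁_nonneg
  have hc := H.c₁_nonneg
  set X := ‖x‖ with hX
  have hX0 : 0 ≤ X := norm_nonneg x
  set Z := 1 + X ^ 2 with hZ
  have hZ1 : 1 ≤ Z := by rw [hZ]; nlinarith
  have hXZ : 1 + X ≤ 2 * Z := by rw [hZ]; nlinarith [sq_nonneg (X - 1)]
  have hXZ2 : (1 + X) ^ 2 ≤ 2 * Z := by rw [hZ]; nlinarith [sq_nonneg (X - 1)]
  -- The mid-point identity: `(y - x, y + x) = ‖y‖² - ‖x‖²`.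
  have energy : ‖y‖ ^ 2 = X ^ 2 + 2 * inner ℝ u (midIncr a σ h s w u) := by
    have e : midIncr a σ h s w u = y - x := eq_sub_of_add_eq' hy.symm
    rw [e, hu, real_inner_smul_left, inner_add_left, inner_sub_right, inner_sub_right,
      real_inner_self_eq_norm_sq, real_inner_self_eq_norm_sq, real_inner_comm y x, hX]
    ring
  have hinc : inner ℝ u (midIncr a σ h s w u) = h * inner ℝ u (a s u)
      - h / 2 * inner ℝ u (∑ r, gradMul (σ r s) u) + ∑ r, w r * inner ℝ u (σ r s u) := by
    rw [midIncr, inner_add_right, inner_sub_right, inner_smul_right, inner_smul_right]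
    congr 1
    rw [inner_sum]
    exact Finset.sum_congr rfl fun r _ => inner_smul_right _ _ _
  have hu2 : ‖u‖ ≤ G * (2 * Z) := hun.trans (mul_le_mul_of_nonneg_left hXZ hG)
  have hu3 : ‖u‖ ^ 2 ≤ G ^ 2 * (2 * Z) := by
    refine (pow_le_pow_left₀ (norm_nonneg u) hun 2).trans ?_
    rw [mul_pow]
    exact mul_le_mul_of_nonneg_left hXZ2 (sq_nonneg _)
  have hdrift : inner ℝ u (a s u) ≤ 2 * (c₁ * G ^ 2 + A * G) * Z := by
    have h1 := H.one_sided_lipschitz s hs u 0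
    rw [sub_zero, inner_sub_right] at h1
    have h2 := real_inner_le_norm u (a s 0)
    have h3 := mul_le_mul_of_nonneg_left (hA s hs) (norm_nonneg u)
    have h4 := mul_le_mul_of_nonneg_left hu2 hA0
    have h5 := mul_le_mul_of_nonneg_left hu3 hc
    linarith
  have hcorr : -inner ℝ u (∑ r, gradMul (σ r s) u) ≤ 2 * m * (L₁ * B) * G * Z := by
    rw [← inner_neg_right]
    refine (real_inner_le_norm _ _).trans ?_
    rw [norm_neg]
    refine (mul_le_mul hu2 (H.norm_sum_gradMul_le hB hs u) (norm_nonneg _)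
      (by positivity)).trans (le_of_eq (by ring))
  set W := ∑ r, |w r| with hW
  have hW0 : 0 ≤ W := Finset.sum_nonneg fun r _ => abs_nonneg _
  -- Moving from `u` to `v` costs one factor `∑ |w r|`; the factor `w r` already in front makes the
  -- error quadratic in the noise.
  have hnoise : ∀ r, |inner ℝ u (σ r s u) - inner ℝ v (σ r s v)|
      ≤ 2 * (B + L₁ * G) * C * W * Z := by
    intro r
    have e : inner ℝ u (σ r s u) - inner ℝ v (σ r s v)
        = inner ℝ (u - v) (σ r s u) + inner ℝ v (σ r s u - σ r s v) := by
      rw [inner_sub_left, inner_sub_right]; ring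
    rw [e]
    refine (abs_add_le _ _).trans ?_
    have h1 : |inner ℝ (u - v) (σ r s u)| ≤ C * W * B :=
      (abs_real_inner_le_norm _ _).trans
        (mul_le_mul huv (hB r s hs u) (norm_nonneg _) (by positivity))
    have h2 : |inner ℝ v (σ r s u - σ r s v)| ≤ G * (2 * Z) * (L₁ * (C * W)) :=
      (abs_real_inner_le_norm _ _).trans
        (mul_le_mul (hvn.trans (mul_le_mul_of_nonneg_left hXZ hG))
          ((H.norm_sigma_sub_le r hs u v).trans (mul_le_mul_of_nonneg_left huv hL))
          (norm_nonneg _) (by positivity))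
    have h3 : C * W * B * 1 ≤ C * W * B * (2 * Z) :=
      mul_le_mul_of_nonneg_left (by linarith) (by positivity)
    linarith
  have hsq : W ^ 2 ≤ m * ∑ r, w r ^ 2 := by
    have := sq_sum_le_card_mul_sum_sq (s := (Finset.univ : Finset (Fin m))) (f := fun r => |w r|)
    simpa using this
  have hsum : ∑ r, w r * inner ℝ u (σ r s u) ≤
      ∑ r, w r * inner ℝ v (σ r s v) + 2 * (B + L₁ * G) * C * Z * (m * ∑ r, w r ^ 2) := by
    have h1 : ∑ r, w r * inner ℝ u (σ r s u) - ∑ r, w r * inner ℝ v (σ r s v)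
        ≤ W * (2 * (B + L₁ * G) * C * W * Z) := by
      rw [← Finset.sum_sub_distrib, hW, Finset.sum_mul]
      refine Finset.sum_le_sum fun r _ => ?_
      rw [← mul_sub]
      refine (le_abs_self _).trans ?_
      rw [abs_mul]
      exact mul_le_mul_of_nonneg_left (hnoise r) (abs_nonneg _)
    have h2 := mul_le_mul_of_nonneg_left hsq
      (by positivity : 0 ≤ 2 * (B + L₁ * G) * C * Z)
    linarith
  have hdiv : Z * ∑ r, w r * (2 * inner ℝ v (σ r s v) / Z)
      = 2 * ∑ r, w r * inner ℝ v (σ r s v) := by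
    rw [Finset.mul_sum, Finset.mul_sum]
    refine Finset.sum_congr rfl fun r _ => ?_
    field_simp
  have h1 := mul_le_mul_of_nonneg_left hdrift hh
  have h2 := mul_le_mul_of_nonneg_left hcorr hh
  rw [mul_add, hdiv, energy, hinc]
  linarith

end CoeffAssumption

/-- Expand `(1 + x)^p` to second order: `h`, `Q` and `S` are bounded, and `S²` is at most a multiple
of `Q`, so `x²` is of order `h + Q`. The term `p * S` stays exact because its expectation will
vanish. -/
lemma rpow_step_le {p Zx Zy τ D h Q S K₁ K₂ K₃ n : ℝ} (hp : 0 ≤ p) (hZx : 0 < Zx) (hZy : 0 < Zy)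
    (hh : 0 ≤ h) (hτ : h ≤ τ) (hQ : 0 ≤ Q) (hQD : Q ≤ n * D ^ 2) (hK₁ : 0 ≤ K₁) (hK₂ : 0 ≤ K₂)
    (hn : 0 ≤ n) (hS : |S| ≤ n * (D * K₃)) (hS2 : S ^ 2 ≤ n * K₃ ^ 2 * Q)
    (hle : Zy ≤ Zx * (1 + K₁ * h + K₂ * Q + S)) :
    Zy ^ p ≤ Zx ^ p * (1 + (p * (K₁ + K₂)
      + p ^ 2 * Real.exp (p * (K₁ * τ + K₂ * (n * D ^ 2) + n * (D * K₃)))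
        * (3 * (K₁ ^ 2 * τ + K₂ ^ 2 * (n * D ^ 2) + n * K₃ ^ 2))) * (h + Q) + p * S) := by
  set x := K₁ * h + K₂ * Q + S with hx
  -- Positivity of `Zy` forces this; no smallness of `h` is used.
  have hx1 : 0 ≤ 1 + x := by
    by_contra hneg
    push Not at hneg
    have := mul_neg_of_pos_of_neg hZx hneg
    have e : Zx * (1 + x) = Zx * (1 + K₁ * h + K₂ * Q + S) := by rw [hx]; ring
    linarith
  have hK₁h := mul_le_mul_of_nonneg_left hτ hK₁
  have hK₂Q := mul_le_mul_of_nonneg_left hQD hK₂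
  have hxR : |x| ≤ K₁ * τ + K₂ * (n * D ^ 2) + n * (D * K₃) := by
    have h1 : 0 ≤ K₁ * h := by positivity
    have h2 : 0 ≤ K₂ * Q := by positivity
    rw [abs_le] at hS ⊢
    constructor <;> linarith [hS.1, hS.2]
  have key := one_add_rpow_le hp hx1 hxR
  have hx2 : x ^ 2 ≤ 3 * (K₁ ^ 2 * τ + K₂ ^ 2 * (n * D ^ 2) + n * K₃ ^ 2) * (h + Q) := by
    have h1 : x ^ 2 ≤ 3 * ((K₁ * h) ^ 2 + (K₂ * Q) ^ 2 + S ^ 2) := by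
      rw [hx]
      nlinarith [sq_nonneg (K₁ * h - K₂ * Q), sq_nonneg (K₁ * h - S), sq_nonneg (K₂ * Q - S)]
    have h2 : (K₁ * h) ^ 2 ≤ K₁ ^ 2 * τ * h := by
      have := mul_le_mul_of_nonneg_left hτ (by positivity : 0 ≤ K₁ ^ 2 * h)
      linarith
    have h3 : (K₂ * Q) ^ 2 ≤ K₂ ^ 2 * (n * D ^ 2) * Q := by
      have := mul_le_mul_of_nonneg_left hQD (by positivity : 0 ≤ K₂ ^ 2 * Q)
      linarith
    have h4 : 0 ≤ K₁ ^ 2 * τ := mul_nonneg (sq_nonneg _) (hh.trans hτ)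
    have h5 : 0 ≤ K₁ ^ 2 * τ * Q := mul_nonneg h4 hQ
    have h6 : 0 ≤ K₂ ^ 2 * (n * D ^ 2) * h := by positivity
    have h7 : 0 ≤ n * K₃ ^ 2 * h := by positivity
    linarith
  have hstep : Zy ^ p ≤ Zx ^ p * (1 + x) ^ p := by
    rw [← Real.mul_rpow hZx.le hx1]
    refine Real.rpow_le_rpow hZy.le ?_ hp
    rw [hx]
    linarith
  refine hstep.trans (mul_le_mul_of_nonneg_left (key.trans ?_) (Real.rpow_nonneg hZx.le _))
  have h8 := mul_le_mul_of_nonneg_left hx2 (by positivity : 0 ≤ p ^ 2 *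
    Real.exp (p * (K₁ * τ + K₂ * (n * D ^ 2) + n * (D * K₃))))
  have h9 : 0 ≤ p * K₁ * Q := by positivity
  have h10 : 0 ≤ p * K₂ * h := by positivity
  have e : p * x = p * K₁ * h + p * K₂ * Q + p * S := by rw [hx]; ring
  rw [e]
  linarith

/-- Moment inequality for one step, with constants that do not depend on the step size: `y` is a
measurable function of the starting point and the noise, and up to a term that is linear in the
noise, the `p`-th power of `1 + ‖x‖²` grows at most by the factor `1 + C (h + ∑ r, (w r)²)`. -/
lemma CoeffAssumption.exists_step_bound {d m : ℕ} {t₀ T : ℝ} {a : ℝ → E d → E d}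
    {σ : Fin m → ℝ → E d → E d} {c₁ c₂ ϰ L₁ L₂ : ℝ}
    (H : CoeffAssumption t₀ T a σ c₁ c₂ ϰ L₁ L₂)
    (hσ : ∃ B : ℝ, ∀ r, ∀ t ∈ Set.Icc t₀ T, ∀ x, ‖σ r t x‖ ≤ B)
    {ε p τ D : ℝ} (hε : 0 < ε) (hp : 0 ≤ p) (hτ : 0 ≤ τ) (hD : 0 ≤ D) :
    ∃ C : ℝ, 0 ≤ C ∧ ∀ h s ρ : ℝ, 0 ≤ h → h ≤ τ → s ∈ Set.Icc t₀ T → 0 ≤ ρ → ρ ≤ D →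
      1 / 2 * (h * c₁ + m * (1 / 2) * L₂ * h + m * L₁ * ρ) ≤ 1 - ε →
      ∃ (g : E d × (Fin m → ℝ) → E d) (μ : Fin m → E d → ℝ), Measurable g ∧
        (∀ r, Measurable (μ r)) ∧ (∀ r x, |μ r x| ≤ C) ∧
        ∀ (x y : E d) (w : Fin m → ℝ), (∀ r, |w r| ≤ ρ) →
          y = x + midIncr a σ h s w ((1 / 2 : ℝ) • (x + y)) →
          y = g (x, w) ∧ (1 + ‖y‖ ^ 2) ^ p ≤
            (1 + ‖x‖ ^ 2) ^ p * (1 + C * (h + ∑ r, w r ^ 2) + ∑ r, w r * μ r x) := by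
  obtain ⟨B', hB'⟩ := hσ
  obtain ⟨A', hA'⟩ := H.drift_zero_bdd
  obtain ⟨B, hBdef⟩ : ∃ B, B = |B'| := ⟨_, rfl⟩
  obtain ⟨A, hAdef⟩ : ∃ A, A = |A'| := ⟨_, rfl⟩
  have hB0 : 0 ≤ B := hBdef ▸ abs_nonneg _
  have hA0 : 0 ≤ A := hAdef ▸ abs_nonneg _
  have hB : ∀ r, ∀ t ∈ Set.Icc t₀ T, ∀ x, ‖σ r t x‖ ≤ B :=
    fun r t ht x => (hB' r t ht x).trans (hBdef ▸ le_abs_self _)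
  have hA : ∀ t ∈ Set.Icc t₀ T, ‖a t 0‖ ≤ A := fun t ht => (hA' t ht).trans (hAdef ▸ le_abs_self _)
  have hL := H.L₁_nonneg
  have hc := H.c₁_nonneg
  obtain ⟨C, hC⟩ := H.exists_midpoint_map hB0 hB hε
  obtain ⟨G, hGdef⟩ : ∃ c : ℝ, c = C * (1 + (τ * A + τ * (m * (L₁ * B))) + D) := ⟨_, rfl⟩
  have hG : 0 ≤ G := by rw [hGdef]; positivity
  obtain ⟨K₁, hK₁def⟩ : ∃ c : ℝ, c = 4 * (c₁ * G ^ 2 + A * G) + 2 * m * (L₁ * B) * G := ⟨_, rfl⟩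
  obtain ⟨K₂, hK₂def⟩ : ∃ c : ℝ, c = 4 * (B + L₁ * G) * C * m := ⟨_, rfl⟩
  obtain ⟨K₃, hK₃def⟩ : ∃ c : ℝ, c = 4 * G * B := ⟨_, rfl⟩
  have hK₁ : 0 ≤ K₁ := by rw [hK₁def]; positivity
  have hK₂ : 0 ≤ K₂ := by rw [hK₂def]; positivity
  have hK₃ : 0 ≤ K₃ := by rw [hK₃def]; positivity
  obtain ⟨K, hKdef⟩ : ∃ c : ℝ, c = p * (K₁ + K₂)
      + p ^ 2 * Real.exp (p * (K₁ * τ + K₂ * (m * D ^ 2) + m * (D * K₃)))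
        * (3 * (K₁ ^ 2 * τ + K₂ ^ 2 * (m * D ^ 2) + m * K₃ ^ 2)) := ⟨_, rfl⟩
  have hK : 0 ≤ K := by rw [hKdef]; positivity
  -- One constant serves two purposes: `K` bounds the growth coefficient and `p * K₃` bounds `μ`.
  refine ⟨K + p * K₃, by positivity, fun h s ρ hh hhτ hs hρ hρD hstep => ?_⟩
  obtain ⟨f, hf, hfS⟩ := hC h s ρ hh hs hstep
  have hgrow : ∀ x (w : Fin m → ℝ), (∀ r, |w r| ≤ D) → ‖f (x, w)‖ ≤ G * (1 + ‖x‖) := by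
    rw [hGdef]
    exact fun x w => H.midpoint_map_growth hB0 hB hA hh hhτ hs hρ hD hf hfS x w
  obtain ⟨ν, hν⟩ : ∃ ν : Fin m → E d → ℝ, ν =
    fun r x => 2 * inner ℝ (f (x, 0)) (σ r s (f (x, 0))) / (1 + ‖x‖ ^ 2) := ⟨_, rfl⟩
  have hνb : ∀ r x, |ν r x| ≤ K₃ := by
    intro r x
    have h1 : ‖f (x, 0)‖ ≤ G * (1 + ‖x‖) := hgrow x 0 (by simpa using fun _ => hD)
    have h2 : |inner ℝ (f (x, 0)) (σ r s (f (x, 0)))| ≤ G * (1 + ‖x‖) * B :=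
      (abs_real_inner_le_norm _ _).trans
        (mul_le_mul h1 (hB r s hs _) (norm_nonneg _) (by positivity))
    have hZ : 0 < 1 + ‖x‖ ^ 2 := by positivity
    have h3 : 1 + ‖x‖ ≤ 2 * (1 + ‖x‖ ^ 2) := by nlinarith [sq_nonneg (‖x‖ - 1), norm_nonneg x]
    simp only [hν]
    rw [hK₃def, abs_div, abs_of_pos hZ, div_le_iff₀ hZ, abs_mul, abs_two]
    have h4 := mul_le_mul_of_nonneg_left h3 (by positivity : 0 ≤ G * B)
    linarith
  -- The end point is recovered from the mid-point as `y = 2u - x`.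
  refine ⟨fun q => (2 : ℝ) • f q - q.1, fun r x => p * ν r x, ?_, ?_, ?_, ?_⟩
  · exact (((hf.continuous.const_smul (2 : ℝ)).sub continuous_fst) :)|>.measurable
  · intro r
    have h1 : Continuous fun x => f (x, 0) := hf.continuous.comp (by fun_prop)
    have h2 : Continuous (σ r s) := (H.contDiff r s hs).continuous
    refine (Continuous.measurable ?_).const_mul p
    rw [hν]
    exact (continuous_const.mul (h1.inner (𝕜 := ℝ) (h2.comp h1))).div
      (by fun_prop : Continuous fun x : E d => 1 + ‖x‖ ^ 2) fun x => by positivity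
  · intro r x
    rw [abs_mul, abs_of_nonneg hp]
    have := mul_le_mul_of_nonneg_left (hνb r x) hp
    linarith
  · intro x y w hw hy
    obtain ⟨u, hu⟩ : ∃ u : E d, u = (1 / 2 : ℝ) • (x + y) := ⟨_, rfl⟩
    rw [← hu] at hy
    have huu : u = x + (1 / 2 : ℝ) • midIncr a σ h s w u := by
      have e : midIncr a σ h s w u = y - x := eq_sub_of_add_eq' hy.symm
      rw [e, hu]
      module
    have hfu := hfS x w u hw huu
    refine ⟨?_, ?_⟩
    · simp only [hfu, hu]
      module
    have hwD : ∀ r, |w r| ≤ D := fun r => (hw r).trans hρD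
    have huv : ‖u - f (x, 0)‖ ≤ C * ∑ r, |w r| := by
      rw [← hfu, ← dist_eq_norm]
      refine (hf.dist_le_mul _ _).trans (mul_le_mul_of_nonneg_left ?_ C.coe_nonneg)
      have hs0 : 0 ≤ ∑ r, |w r| := Finset.sum_nonneg fun _ _ => abs_nonneg _
      refine max_le (by simpa using hs0) ?_
      refine (dist_pi_le_iff hs0).2 fun r => ?_
      simpa [Real.dist_eq] using
        Finset.single_le_sum (f := fun r => |w r|) (fun _ _ => abs_nonneg _) (Finset.mem_univ r)
    have hmain := H.one_add_norm_sq_step_le hB0 hB hA hh hs hG C.coe_nonneg hy hu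
      (hfu ▸ hgrow x w hwD) (hgrow x 0 (by simpa using fun _ => hD)) huv
    have hνx : ∀ r, 2 * inner ℝ (f (x, 0)) (σ r s (f (x, 0))) / (1 + ‖x‖ ^ 2) = ν r x :=
      fun r => by rw [hν]
    simp only [hνx] at hmain
    rw [← hK₁def, ← hK₂def] at hmain
    have hQ : 0 ≤ ∑ r, w r ^ 2 := Finset.sum_nonneg fun _ _ => sq_nonneg _
    have hQD : ∑ r, w r ^ 2 ≤ m * D ^ 2 := by
      refine (Finset.sum_le_card_nsmul _ _ (D ^ 2) fun r _ => ?_).trans (by simp)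
      rw [← sq_abs]
      exact pow_le_pow_left₀ (abs_nonneg _) (hwD r) 2
    have hS : |∑ r, w r * ν r x| ≤ m * (D * K₃) := by
      refine (Finset.abs_sum_le_sum_abs _ _).trans
        ((Finset.sum_le_card_nsmul _ _ (D * K₃) fun r _ => ?_).trans (by simp))
      rw [abs_mul]
      exact mul_le_mul (hwD r) (hνb r x) (abs_nonneg _) hD
    have hS2 : (∑ r, w r * ν r x) ^ 2 ≤ m * K₃ ^ 2 * ∑ r, w r ^ 2 := by
      have h1 := Finset.sum_mul_sq_le_sq_mul_sq Finset.univ w fun r => ν r x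
      have h2 : ∑ r, ν r x ^ 2 ≤ m * K₃ ^ 2 := by
        refine (Finset.sum_le_card_nsmul _ _ (K₃ ^ 2) fun r _ => ?_).trans (by simp)
        rw [← sq_abs]
        exact pow_le_pow_left₀ (abs_nonneg _) (hνb r x) 2
      have h3 := mul_le_mul_of_nonneg_left h2 hQ
      linarith
    have hfin := rpow_step_le hp (by positivity) (by positivity) hh hhτ hQ hQD hK₁ hK₂
      (Nat.cast_nonneg m) hS hS2 hmain
    rw [← hKdef] at hfin
    refine hfin.trans (mul_le_mul_of_nonneg_left ?_ (by positivity))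
    have e : ∑ r, w r * (p * ν r x) = p * ∑ r, w r * ν r x := by
      rw [Finset.mul_sum]
      exact Finset.sum_congr rfl fun r _ => by ring
    rw [e]
    have h4 : 0 ≤ p * K₃ * (h + ∑ r, w r ^ 2) := by positivity
    linarith

end MidPoint

/-! ### Independence, moments of the noise, and the expectation of one step. -/

namespace MidPoint

lemma indepFun_prodMk_left {Ω α β γ : Type*} [MeasurableSpace Ω] [MeasurableSpace α]
    [MeasurableSpace β] [MeasurableSpace γ] {P : Measure Ω} [IsProbabilityMeasure P]
    {X : Ω → α} {F : Ω → β} {G : Ω → γ} (hX : Measurable X) (hF : Measurable F)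
    (hG : Measurable G) (hXFG : IndepFun X (fun ω => (F ω, G ω)) P) (hFG : IndepFun F G P) :
    IndepFun (fun ω => (X ω, F ω)) G P := by
  have : IsProbabilityMeasure (P.map X) := Measure.isProbabilityMeasure_map hX.aemeasurable
  have : IsProbabilityMeasure (P.map F) := Measure.isProbabilityMeasure_map hF.aemeasurable
  have : IsProbabilityMeasure (P.map G) := Measure.isProbabilityMeasure_map hG.aemeasurable
  have hXF : IndepFun X F P := hXFG.comp measurable_id measurable_fst
  rw [indepFun_iff_map_prod_eq_prod_map_map (hX.prodMk hF).aemeasurable hG.aemeasurable]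
  have e1 := (indepFun_iff_map_prod_eq_prod_map_map hX.aemeasurable
    (hF.prodMk hG).aemeasurable).1 hXFG
  have e2 := (indepFun_iff_map_prod_eq_prod_map_map hF.aemeasurable hG.aemeasurable).1 hFG
  have e3 := (indepFun_iff_map_prod_eq_prod_map_map hX.aemeasurable hF.aemeasurable).1 hXF
  rw [e3]
  apply MeasurableEquiv.prodAssoc.map_measurableEquiv_injective
  rw [Measure.prodAssoc_prod, ← e2, ← e1,
    Measure.map_map MeasurableEquiv.prodAssoc.measurable ((hX.prodMk hF).prodMk hG)]
  rfl

section Noise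

variable {Ω : Type*} [MeasurableSpace Ω] {P : Measure Ω} {ξ : Ω → ℝ}

lemma integrable_zeta_pow [IsFiniteMeasure P] (l h : ℝ) (hξ : Measurable ξ) (n : ℕ) :
    Integrable (fun ω => zeta l h (ξ ω) ^ n) P := by
  refine Integrable.of_bound (((measurable_zeta l h).comp hξ).pow_const n).aestronglyMeasurable
    (truncLevel l h ^ n) (.of_forall fun ω => ?_)
  rw [norm_pow, Real.norm_eq_abs]
  exact pow_le_pow_left₀ (abs_nonneg _) (abs_zeta_le l h _) n

/-- The truncation is odd and the Gaussian law is symmetric. -/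
lemma integral_zeta (l h : ℝ) (hξ : Measurable ξ) (hlaw : P.map ξ = gaussianReal 0 1) :
    ∫ ω, zeta l h (ξ ω) ∂P = 0 := by
  have hz := (measurable_zeta l h).aestronglyMeasurable (μ := gaussianReal 0 1)
  have e1 : ∫ ω, zeta l h (ξ ω) ∂P = ∫ x, zeta l h x ∂gaussianReal 0 1 := by
    rw [← hlaw, integral_map hξ.aemeasurable (hlaw ▸ hz)]
  have e2 : ∫ x, zeta l h x ∂gaussianReal 0 1 = ∫ x, zeta l h (-x) ∂gaussianReal 0 1 := by
    have hneg : (gaussianReal 0 1).map (fun x => -x) = gaussianReal 0 1 := by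
      rw [gaussianReal_map_neg, neg_zero]
    conv_lhs => rw [← hneg]
    rw [integral_map measurable_neg.aemeasurable
      (measurable_zeta l h).aestronglyMeasurable]
  simp only [zeta_neg, integral_neg] at e2
  rw [e1]
  linarith

lemma integral_zeta_sq_le (l h : ℝ) (hξ : Measurable ξ) (hlaw : P.map ξ = gaussianReal 0 1) :
    ∫ ω, zeta l h (ξ ω) ^ 2 ∂P ≤ 1 := by
  have e1 : ∫ ω, zeta l h (ξ ω) ^ 2 ∂P = ∫ x, zeta l h x ^ 2 ∂gaussianReal 0 1 := by
    rw [← hlaw, integral_map hξ.aemeasurable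
      ((measurable_zeta l h).pow_const 2).aestronglyMeasurable]
  have hv : ∫ x, x ^ 2 ∂gaussianReal 0 1 = 1 := by
    have h1 := variance_of_integral_eq_zero (μ := gaussianReal 0 1) (X := fun x => x)
      measurable_id.aemeasurable integral_id_gaussianReal
    rw [variance_fun_id_gaussianReal] at h1
    simpa using h1.symm
  have hint : Integrable (fun x : ℝ => x ^ 2) (gaussianReal 0 1) :=
    (memLp_id_gaussianReal 2).integrable_sq
  rw [e1, ← hv]
  refine integral_mono (integrable_zeta_pow l h measurable_id 2) hint fun x => ?_
  exact sq_le_sq.2 (abs_zeta_le_abs l h x)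

end Noise

namespace IsScheme

variable {d m : ℕ} {Ω : Type*} [MeasurableSpace Ω] {P : Measure Ω}
  {lam l t₀ T : ℝ} {a : ℝ → E d → E d} {σ : Fin m → ℝ → E d → E d} {N : ℕ}
  {ξ : Fin N → Fin m → Ω → ℝ} {X : ℕ → Ω → E d}

/-- The noise indices before time step `k`. -/
def past (N m k : ℕ) : Finset (Fin N × Fin m) :=
  Finset.univ.filter fun i => (i.1 : ℕ) < k

/-- If each step of the scheme is given by a measurable map, then the approximation at time step `k`
is a function of the initial value and the past noise. -/
lemma exists_eq_past
    (hg : ∀ k : Fin N, ∃ g : E d × (Fin m → ℝ) → E d, Measurable g ∧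
      ∀ᵐ ω ∂P, X (k + 1) ω = g (X k ω, fun r => ξ k r ω)) (k : ℕ) (hk : k ≤ N) :
    ∃ Φ : E d × (past N m k → ℝ) → E d, Measurable Φ ∧
      ∀ᵐ ω ∂P, X k ω = Φ (X 0 ω, fun i => ξ i.1.1 i.1.2 ω) := by
  induction k with
  | zero => exact ⟨Prod.fst, measurable_fst, .of_forall fun _ => rfl⟩
  | succ k ih =>
    obtain ⟨Φ, hΦ, hX⟩ := ih (by omega)
    obtain ⟨g, hgm, hgX⟩ := hg ⟨k, by omega⟩
    have hsub : ∀ i : past N m k, i.1 ∈ past N m (k + 1) := fun i => by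
      have := i.2
      simp only [past, Finset.mem_filter, Finset.mem_univ, true_and] at this ⊢
      omega
    have hmem : ∀ r : Fin m, ((⟨k, by omega⟩ : Fin N), r) ∈ past N m (k + 1) := fun r => by
      simp [past]
    refine ⟨fun q => g (Φ (q.1, fun i => q.2 ⟨i.1, hsub i⟩), fun r => q.2 ⟨_, hmem r⟩), ?_, ?_⟩
    · refine hgm.comp (Measurable.prodMk (hΦ.comp (measurable_fst.prodMk ?_)) ?_)
      · exact measurable_pi_lambda _ fun i => (measurable_pi_apply _).comp measurable_snd
      · exact measurable_pi_lambda _ fun r => (measurable_pi_apply _).comp measurable_snd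
    · filter_upwards [hX, hgX] with ω h1 h2
      rw [h2, h1]

/-- The initial value together with the past noise is independent of `ξ k r`, and `X k` is a
function of them. Each `r` can be treated separately because the one-step bound has no products of
different noises. -/
lemma indepFun_noise [IsProbabilityMeasure P] (S : IsScheme P lam l t₀ T a σ N ξ X)
    (hg : ∀ k : Fin N, ∃ g : E d × (Fin m → ℝ) → E d, Measurable g ∧
      ∀ᵐ ω ∂P, X (k + 1) ω = g (X k ω, fun r => ξ k r ω)) (k : Fin N) (r : Fin m) :
    IndepFun (X k) (ξ k r) P := by
  obtain ⟨Φ, hΦ, hX⟩ := exists_eq_past hg k k.2.le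
  have hpast : Measurable fun ω (i : past N m k) => ξ i.1.1 i.1.2 ω :=
    measurable_pi_lambda _ fun i => S.measurable_noise _ _
  have h1 : IndepFun (fun ω (i : past N m k) => ξ i.1.1 i.1.2 ω) (ξ k r) P := by
    have hd : Disjoint (past N m k) {(k, r)} := by simp [past]
    exact (S.iIndep.indepFun_finset _ _ hd fun i => S.measurable_noise i.1 i.2).comp
      measurable_id (measurable_pi_apply (⟨(k, r), by simp⟩ : ({(k, r)} : Finset _)))
  have h2 : IndepFun (X 0) (fun ω => ((fun i : past N m k => ξ i.1.1 i.1.2 ω), ξ k r ω)) P := by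
    refine S.indep_initial.comp (φ := id)
      (ψ := fun v : Fin N × Fin m → ℝ => ((fun i : past N m k => v i.1), v (k, r)))
      measurable_id (Measurable.prodMk ?_ (measurable_pi_apply _))
    exact measurable_pi_lambda _ fun i => measurable_pi_apply _
  have h3 := indepFun_prodMk_left S.measurable_initial hpast (S.measurable_noise k r) h2 h1
  have h4 : IndepFun (fun ω => Φ (X 0 ω, fun i => ξ i.1.1 i.1.2 ω)) (ξ k r) P :=
    h3.comp hΦ measurable_id
  exact h4.congr (hX.mono fun _ h => h.symm) .rfl

lemma aemeasurable (S : IsScheme P lam l t₀ T a σ N ξ X)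
    (hg : ∀ k : Fin N, ∃ g : E d × (Fin m → ℝ) → E d, Measurable g ∧
      ∀ᵐ ω ∂P, X (k + 1) ω = g (X k ω, fun r => ξ k r ω)) {k : ℕ} (hk : k ≤ N) :
    AEMeasurable (X k) P := by
  obtain ⟨Φ, hΦ, hX⟩ := exists_eq_past hg k hk
  exact ⟨_, hΦ.comp (S.measurable_initial.prodMk
    (measurable_pi_lambda _ fun i => S.measurable_noise _ _)), hX⟩

end IsScheme

/-- The expectation of a one-step bound whose noise is centred and independent of the present. -/
lemma integral_step_le {Ω : Type*} [MeasurableSpace Ω] {P : Measure Ω} [IsProbabilityMeasure P]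
    {α : Type*} [MeasurableSpace α] {m : ℕ} {Y : Ω → α} {ζ : Fin m → Ω → ℝ} {V : α → ℝ}
    {μ : Fin m → α → ℝ} {W : Ω → ℝ} {C h : ℝ} (hC : 0 ≤ C) (hh : 0 ≤ h) (hY : AEMeasurable Y P)
    (hindep : ∀ r, IndepFun Y (ζ r) P)
    (hζ1 : ∀ r, Integrable (ζ r) P) (hζ2 : ∀ r, Integrable (fun ω => ζ r ω ^ 2) P)
    (hmean : ∀ r, ∫ ω, ζ r ω ∂P = 0) (hvar : ∀ r, ∫ ω, ζ r ω ^ 2 ∂P ≤ 1)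
    (hV : Measurable V) (hV0 : ∀ y, 0 ≤ V y) (hVint : Integrable (fun ω => V (Y ω)) P)
    (hμ : ∀ r, Measurable (μ r)) (hμC : ∀ r y, |μ r y| ≤ C)
    (hW : AEMeasurable W P) (hW0 : ∀ ω, 0 ≤ W ω)
    (hle : ∀ᵐ ω ∂P, W ω ≤ V (Y ω) * (1 + C * (h + ∑ r, (ζ r ω * √h) ^ 2)
      + ∑ r, ζ r ω * √h * μ r (Y ω))) :
    Integrable W P ∧ ∫ ω, W ω ∂P ≤ (1 + C * (1 + m) * h) * ∫ ω, V (Y ω) ∂P := by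
  -- Independence, besides factoring the expectations, makes the products integrable when the
  -- factors are merely integrable.
  have hi2 : ∀ r, IndepFun (fun ω => V (Y ω)) (fun ω => ζ r ω ^ 2) P :=
    fun r => (hindep r).comp hV (measurable_id.pow_const 2)
  have hi1 : ∀ r, IndepFun (fun ω => V (Y ω) * μ r (Y ω)) (ζ r) P :=
    fun r => (hindep r).comp (hV.mul (hμ r)) measurable_id
  have hVμ : ∀ r, Integrable (fun ω => V (Y ω) * μ r (Y ω)) P := fun r =>
    hVint.mul_bdd (c := C) ((hμ r).comp_aemeasurable hY).aestronglyMeasurable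
      (.of_forall fun ω => hμC r _)
  have hI2 : ∀ r, Integrable (fun ω => V (Y ω) * ζ r ω ^ 2) P :=
    fun r => (hi2 r).integrable_mul hVint (hζ2 r)
  have hI1 : ∀ r, Integrable (fun ω => V (Y ω) * μ r (Y ω) * ζ r ω) P :=
    fun r => (hi1 r).integrable_mul (hVμ r) (hζ1 r)
  set R : Ω → ℝ := fun ω => (1 + C * h) * V (Y ω) + C * h * ∑ r, V (Y ω) * ζ r ω ^ 2
    + √h * ∑ r, V (Y ω) * μ r (Y ω) * ζ r ω with hR
  have hRle : ∀ᵐ ω ∂P, W ω ≤ R ω := by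
    filter_upwards [hle] with ω hω
    refine hω.trans (le_of_eq ?_)
    have e1 : ∑ r, (ζ r ω * √h) ^ 2 = h * ∑ r, ζ r ω ^ 2 := by
      rw [Finset.mul_sum]
      exact Finset.sum_congr rfl fun r _ => by rw [mul_pow, Real.sq_sqrt hh, mul_comm]
    have e2 : ∑ r, ζ r ω * √h * μ r (Y ω) = √h * ∑ r, μ r (Y ω) * ζ r ω := by
      rw [Finset.mul_sum]
      exact Finset.sum_congr rfl fun r _ => by ring
    have e3 : ∑ r, V (Y ω) * μ r (Y ω) * ζ r ω = V (Y ω) * ∑ r, μ r (Y ω) * ζ r ω := by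
      rw [Finset.mul_sum]
      exact Finset.sum_congr rfl fun r _ => by ring
    simp only [hR]
    rw [e1, e2, e3, ← Finset.mul_sum]
    ring
  have i1 := hVint.const_mul (1 + C * h)
  have i2 := (integrable_finsetSum Finset.univ fun r _ => hI2 r).const_mul (C * h)
  have i3 := (integrable_finsetSum Finset.univ fun r _ => hI1 r).const_mul √h
  have hRint : Integrable R P := (i1.add i2).add i3
  have hWint : Integrable W P := by
    refine hRint.mono' hW.aestronglyMeasurable ?_
    filter_upwards [hRle] with ω hω
    rwa [Real.norm_of_nonneg (hW0 ω)]
  refine ⟨hWint, (integral_mono_ae hWint hRint hRle).trans ?_⟩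
  have hVI : 0 ≤ ∫ ω, V (Y ω) ∂P := integral_nonneg fun ω => hV0 _
  have eR : ∫ ω, R ω ∂P = (1 + C * h) * ∫ ω, V (Y ω) ∂P
      + C * h * ∑ r, ∫ ω, V (Y ω) * ζ r ω ^ 2 ∂P
      + √h * ∑ r, ∫ ω, V (Y ω) * μ r (Y ω) * ζ r ω ∂P := by
    rw [← integral_finsetSum _ fun r _ => hI2 r, ← integral_finsetSum _ fun r _ => hI1 r,
      ← integral_const_mul, ← integral_const_mul, ← integral_const_mul]
    exact (integral_add (i1.add i2) i3).trans (congrArg₂ _ (integral_add i1 i2) rfl)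
  have e1 : ∀ r, ∫ ω, V (Y ω) * μ r (Y ω) * ζ r ω ∂P = 0 := fun r => by
    rw [(hi1 r).integral_fun_mul_eq_mul_integral (hVμ r).1 (hζ1 r).1, hmean r, mul_zero]
  have e2 : ∑ r, ∫ ω, V (Y ω) * ζ r ω ^ 2 ∂P ≤ m * ∫ ω, V (Y ω) ∂P := by
    refine (Finset.sum_le_card_nsmul _ _ (∫ ω, V (Y ω) ∂P) fun r _ => ?_).trans (by simp)
    rw [(hi2 r).integral_fun_mul_eq_mul_integral hVint.1 (hζ2 r).1]
    exact mul_le_of_le_one_right hVI (hvar r)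
  rw [eR, Finset.sum_eq_zero fun r _ => e1 r, mul_zero, add_zero]
  have := mul_le_mul_of_nonneg_left e2 (mul_nonneg hC hh)
  linarith

end MidPoint

/-! ### The moment of the initial value. -/

namespace MidPoint

/-- Cauchy–Schwarz, in the form of nonnegativity of the variance. -/
lemma integral_le_rpow_half {Ω : Type*} [MeasurableSpace Ω] {P : Measure Ω}
    [IsProbabilityMeasure P] {f : Ω → ℝ} (hf : AEMeasurable f P)
    (hf2 : Integrable (fun ω => f ω ^ 2) P) :
    Integrable f P ∧ ∫ ω, f ω ∂P ≤ (∫ ω, f ω ^ 2 ∂P) ^ (1 / 2 : ℝ) := by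
  have hmem : MemLp f 2 P := (memLp_two_iff_integrable_sq hf.aestronglyMeasurable).2 hf2
  refine ⟨hmem.integrable (by norm_num), ?_⟩
  have hv := variance_eq_sub hmem
  have hv0 := variance_nonneg f P
  rw [← Real.sqrt_eq_rpow]
  refine Real.le_sqrt_of_sq_le ?_
  change (P[f]) ^ 2 ≤ P[f ^ 2]
  linarith

lemma one_add_sq_rpow_sq_le {x p s : ℝ} (hx : 0 ≤ x) (hp : 0 ≤ p) (hs : 4 * p ≤ s) :
    ((1 + x ^ 2) ^ p) ^ 2 ≤ ((2 : ℝ) ^ p) ^ 2 * (1 + x ^ s) := by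
  have hxs : 0 ≤ x ^ s := Real.rpow_nonneg hx s
  rcases le_total x 1 with h1 | h1
  · have h2 : (1 + x ^ 2) ^ p ≤ (2 : ℝ) ^ p :=
      Real.rpow_le_rpow (by positivity) (by nlinarith) hp
    have h3 := pow_le_pow_left₀ (by positivity) h2 2
    have h4 : 0 ≤ ((2 : ℝ) ^ p) ^ 2 * x ^ s := by positivity
    linarith
  · have h2 : (1 + x ^ 2) ^ p ≤ (2 * x ^ 2) ^ p :=
      Real.rpow_le_rpow (by positivity) (by nlinarith) hp
    have h3 := pow_le_pow_left₀ (by positivity) h2 2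
    have h4 : ((2 * x ^ 2) ^ p) ^ 2 = ((2 : ℝ) ^ p) ^ 2 * x ^ (4 * p) := by
      rw [Real.mul_rpow (by norm_num) (by positivity), mul_pow]
      congr 1
      rw [← Real.rpow_natCast x 2, ← Real.rpow_mul hx, ← Real.rpow_natCast, ← Real.rpow_mul hx]
      congr 1
      push_cast
      ring
    have h5 : x ^ (4 * p) ≤ x ^ s := Real.rpow_le_rpow_of_exponent_le h1 hs
    have h6 := mul_le_mul_of_nonneg_left (h5.trans (by linarith : x ^ s ≤ 1 + x ^ s))
      (by positivity : 0 ≤ ((2 : ℝ) ^ p) ^ 2)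
    linarith

lemma integral_initial_le {Ω F : Type*} [MeasurableSpace Ω] [NormedAddCommGroup F]
    [MeasurableSpace F] [OpensMeasurableSpace F] {P : Measure Ω} [IsProbabilityMeasure P]
    {Y : Ω → F} (hY : Measurable Y) {p s : ℝ} (hp : 0 ≤ p) (hs : 4 * p ≤ s)
    (hint : Integrable (fun ω => ‖Y ω‖ ^ s) P) :
    Integrable (fun ω => (1 + ‖Y ω‖ ^ 2) ^ p) P ∧
      ∫ ω, (1 + ‖Y ω‖ ^ 2) ^ p ∂P ≤ 2 ^ p * (1 + ∫ ω, ‖Y ω‖ ^ s ∂P) ^ (1 / 2 : ℝ) := by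
  have hm : Measurable fun ω => (1 + ‖Y ω‖ ^ 2) ^ p :=
    ((hY.norm.pow_const 2).const_add 1).pow_const p
  have hR : Integrable (fun ω => ((2 : ℝ) ^ p) ^ 2 * (1 + ‖Y ω‖ ^ s)) P :=
    ((integrable_const 1).add hint).const_mul _
  have hle : ∀ ω, ((1 + ‖Y ω‖ ^ 2) ^ p) ^ 2 ≤ ((2 : ℝ) ^ p) ^ 2 * (1 + ‖Y ω‖ ^ s) :=
    fun ω => one_add_sq_rpow_sq_le (norm_nonneg _) hp hs
  have hsq : Integrable (fun ω => ((1 + ‖Y ω‖ ^ 2) ^ p) ^ 2) P :=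
    hR.mono' (hm.pow_const 2).aestronglyMeasurable (.of_forall fun ω => by
      rw [Real.norm_of_nonneg (sq_nonneg _)]; exact hle ω)
  obtain ⟨h1, h2⟩ := integral_le_rpow_half hm.aemeasurable hsq
  refine ⟨h1, h2.trans ?_⟩
  have h3 : ∫ ω, ((1 + ‖Y ω‖ ^ 2) ^ p) ^ 2 ∂P ≤
      ((2 : ℝ) ^ p) ^ 2 * (1 + ∫ ω, ‖Y ω‖ ^ s ∂P) := by
    refine (integral_mono hsq hR hle).trans (le_of_eq ?_)
    rw [integral_const_mul, integral_add (integrable_const 1) hint]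
    simp
  have h4 : 0 ≤ ∫ ω, ‖Y ω‖ ^ s ∂P := integral_nonneg fun ω => by positivity
  refine (Real.rpow_le_rpow (integral_nonneg fun ω => sq_nonneg _) h3 (by norm_num)).trans
    (le_of_eq ?_)
  rw [Real.mul_rpow (by positivity) (by positivity), ← Real.sqrt_eq_rpow,
    Real.sqrt_sq (by positivity)]

end MidPoint

/-! ### Iteration over the time steps. -/

theorem mainTheorem7 {d m : ℕ} (t₀ T : ℝ) (hT : t₀ < T)
    (a : ℝ → MidPoint.E d → MidPoint.E d) (σ : Fin m → ℝ → MidPoint.E d → MidPoint.E d)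
    (c₁ c₂ ϰ L₁ L₂ : ℝ) (hcoeff : MidPoint.CoeffAssumption t₀ T a σ c₁ c₂ ϰ L₁ L₂)
    (hσ : ∃ B : ℝ, ∀ r, ∀ t ∈ Set.Icc t₀ T, ∀ x, ‖σ r t x‖ ≤ B)
    (l : ℝ) (hl : 1 ≤ l)
    (ε : ℝ) (hε0 : 0 < ε) (hε1 : ε < 1) (h₀ : ℝ) (hh₀ : 0 < h₀)
    (hstep : ∀ h : ℝ, 0 < h → h ≤ h₀ → MidPoint.stepFactor m (1 / 2) l c₁ L₁ L₂ h ≤ 1 - ε)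
    (p : ℝ) (hp : 1 ≤ p) :
    ∃ K : ℝ, 0 < K ∧
      ∀ {Ω : Type*} [MeasurableSpace Ω] (P : Measure Ω) [IsProbabilityMeasure P]
        (N : ℕ) (_ : 0 < N) (_ : (T - t₀) / N ≤ h₀)
        (ξ : Fin N → Fin m → Ω → ℝ) (X : ℕ → Ω → MidPoint.E d)
        (_ : MidPoint.IsScheme P (1 / 2) l t₀ T a σ N ξ X)
        (_ : ∀ q : ℝ, 1 ≤ q → Integrable (fun ω => ‖X 0 ω‖ ^ (2 * q)) P),
        ∀ k : ℕ, k ≤ N →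
          Integrable (fun ω => ‖X k ω‖ ^ (2 * p)) P ∧
          ∫ ω, ‖X k ω‖ ^ (2 * p) ∂P ≤
            K * (1 + ∫ ω, ‖X 0 ω‖ ^ (4 * (p + 1) * ϰ - 4) ∂P) ^ (1 / 2 : ℝ) := by
  have hτ : 0 < T - t₀ := sub_pos.2 hT
  have hp0 : 0 ≤ p := by linarith
  have hl0 : 0 ≤ l := by linarith
  obtain ⟨C, hC, hbound⟩ := hcoeff.exists_step_bound hσ hε0 hp0 hτ.le
    (Real.sqrt_nonneg (2 * l * (1 + (T - t₀) ^ 2)))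
  refine ⟨Real.exp (C * (1 + m) * (T - t₀)) * 2 ^ p, by positivity, ?_⟩
  intro Ω _ P _ N hN hNh ξ X S hmom
  have hN0 : (0 : ℝ) < N := Nat.cast_pos.2 hN
  have hN1 : (1 : ℝ) ≤ N := Nat.one_le_cast.2 hN
  obtain ⟨h, hh⟩ : ∃ h, h = (T - t₀) / N := ⟨_, rfl⟩
  have hpos : 0 < h := hh ▸ div_pos hτ hN0
  have hNT : N * h = T - t₀ := by rw [hh]; field_simp
  have hle : h ≤ T - t₀ := by rw [← hNT]; exact le_mul_of_one_le_left hpos.le hN1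
  have hmid : ∀ k : Fin N, t₀ + (k : ℕ) * h + 1 / 2 * h ∈ Set.Icc t₀ T := fun k => by
    have hk : ((k : ℕ) : ℝ) + 1 ≤ N := by exact_mod_cast k.2
    have h1 := mul_le_mul_of_nonneg_right hk hpos.le
    have h2 : 0 ≤ ((k : ℕ) : ℝ) * h := by positivity
    constructor <;> linarith
  have hfac := hstep h hpos (hh ▸ hNh)
  rw [MidPoint.stepFactor] at hfac
  choose g μ hg hμ hμC hstepb using fun k : Fin N => hbound h _ _ hpos.le hle (hmid k)
    (Real.sqrt_nonneg (2 * l * h * |Real.log h|))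
    (MidPoint.sqrt_mul_abs_log_le hl0 hpos hle) hfac
  -- Scaling the truncation level by `√h` gives exactly the square root in the step-size condition.
  have hw : ∀ k r ω, |MidPoint.zeta l h (ξ k r ω) * √h| ≤ √(2 * l * h * |Real.log h|) := by
    intro k r ω
    rw [abs_mul, abs_of_nonneg (Real.sqrt_nonneg h), mul_comm,
      ← MidPoint.sqrt_mul_truncLevel l hpos.le]
    exact mul_le_mul_of_nonneg_left (MidPoint.abs_zeta_le _ _ _) (Real.sqrt_nonneg h)
  have hone : ∀ k : Fin N, ∀ᵐ ω ∂P,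
      X (k + 1) ω = g k (X k ω, fun r => MidPoint.zeta l h (ξ k r ω) * √h) ∧
      (1 + ‖X (k + 1) ω‖ ^ 2) ^ p ≤ (1 + ‖X k ω‖ ^ 2) ^ p *
        (1 + C * (h + ∑ r, (MidPoint.zeta l h (ξ k r ω) * √h) ^ 2)
          + ∑ r, MidPoint.zeta l h (ξ k r ω) * √h * μ k r (X k ω)) := fun k => by
    have hk := S.step k
    rw [← hh] at hk
    filter_upwards [hk] with ω hω
    exact hstepb k _ _ _ (fun r => hw k r ω) hω.eq_add_midIncr
  have hmap : ∀ k : Fin N, ∃ G : MidPoint.E d × (Fin m → ℝ) → MidPoint.E d, Measurable G ∧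
      ∀ᵐ ω ∂P, X (k + 1) ω = G (X k ω, fun r => ξ k r ω) := fun k => by
    refine ⟨fun q => g k (q.1, fun r => MidPoint.zeta l h (q.2 r) * √h),
      (hg k).comp (measurable_fst.prodMk (measurable_pi_lambda _ fun r => ?_)),
      (hone k).mono fun ω hω => hω.1⟩
    exact ((MidPoint.measurable_zeta l h).comp
      ((measurable_pi_apply r).comp measurable_snd)).mul_const _
  have hϰ := hcoeff.one_le_ϰ
  -- Equality holds at `ϰ = 1`; this is where the exponent in the statement dominates the `4p`
  -- required by Cauchy–Schwarz.
  have hs : 4 * p ≤ 4 * (p + 1) * ϰ - 4 := by nlinarith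
  have hmom0 : Integrable (fun ω => ‖X 0 ω‖ ^ (4 * (p + 1) * ϰ - 4)) P := by
    have := hmom (2 * (p + 1) * ϰ - 2) (by nlinarith)
    rwa [show 2 * (2 * (p + 1) * ϰ - 2) = 4 * (p + 1) * ϰ - 4 by ring] at this
  obtain ⟨hinit, hinitle⟩ := MidPoint.integral_initial_le S.measurable_initial hp0 hs hmom0
  have hVm : Measurable fun x : MidPoint.E d => (1 + ‖x‖ ^ 2) ^ p :=
    ((measurable_norm.pow_const 2).const_add 1).pow_const p
  have hrec : ∀ k : ℕ, k ≤ N → Integrable (fun ω => (1 + ‖X k ω‖ ^ 2) ^ p) P ∧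
      ∫ ω, (1 + ‖X k ω‖ ^ 2) ^ p ∂P ≤
        (1 + C * (1 + m) * h) ^ k * ∫ ω, (1 + ‖X 0 ω‖ ^ 2) ^ p ∂P := by
    intro k
    induction k with
    | zero => exact fun _ => ⟨hinit, by simp⟩
    | succ k ih =>
      intro hk
      obtain ⟨ih1, ih2⟩ := ih (by omega)
      obtain ⟨j, hj⟩ : ∃ j : Fin N, (j : ℕ) = k := ⟨⟨k, by omega⟩, rfl⟩
      subst hj
      have hmz := fun r => S.measurable_noise j r
      obtain ⟨r1, r2⟩ := MidPoint.integral_step_le (Y := X j)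
        (ζ := fun r ω => MidPoint.zeta l h (ξ j r ω))
        (V := fun x => (1 + ‖x‖ ^ 2) ^ p) (W := fun ω => (1 + ‖X (j + 1) ω‖ ^ 2) ^ p)
        hC hpos.le (S.aemeasurable hmap j.2.le)
        (fun r => (S.indepFun_noise hmap j r).comp measurable_id (MidPoint.measurable_zeta l h))
        (fun r => by simpa using MidPoint.integrable_zeta_pow l h (hmz r) 1)
        (fun r => MidPoint.integrable_zeta_pow l h (hmz r) 2)
        (fun r => MidPoint.integral_zeta l h (hmz r) (S.gaussian j r))
        (fun r => MidPoint.integral_zeta_sq_le l h (hmz r) (S.gaussian j r))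
        hVm (fun x => by positivity) ih1 (hμ j) (hμC j)
        (hVm.comp_aemeasurable (S.aemeasurable hmap hk)) (fun ω => by positivity)
        ((hone j).mono fun ω hω => hω.2)
      refine ⟨r1, r2.trans ?_⟩
      exact (mul_le_mul_of_nonneg_left ih2 (by positivity)).trans_eq (by ring)
  intro k hk
  obtain ⟨hint, hintle⟩ := hrec k hk
  have hdom : ∀ ω, ‖X k ω‖ ^ (2 * p) ≤ (1 + ‖X k ω‖ ^ 2) ^ p := fun ω => by
    rw [Real.rpow_mul (norm_nonneg _), Real.rpow_two]
    exact Real.rpow_le_rpow (by positivity) (by linarith) hp0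
  have hXint : Integrable (fun ω => ‖X k ω‖ ^ (2 * p)) P :=
    hint.mono' ((S.aemeasurable hmap hk).norm.pow_const _).aestronglyMeasurable
      (.of_forall fun ω => by rw [Real.norm_of_nonneg (by positivity)]; exact hdom ω)
  refine ⟨hXint, (integral_mono hXint hint hdom).trans (hintle.trans ?_)⟩
  -- Discrete Gronwall: `1 + x ≤ exp x`, and `k h ≤ N h = T - t₀`.
  have hgrowth : (1 + C * (1 + m) * h) ^ k ≤ Real.exp (C * (1 + m) * (T - t₀)) := by
    refine (pow_le_pow_left₀ (by positivity) ((add_comm _ _).trans_le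
      (Real.add_one_le_exp (C * (1 + m) * h))) k).trans ?_
    rw [← Real.exp_nat_mul, ← hNT]
    refine Real.exp_le_exp.2 ?_
    have h1 : (k : ℝ) ≤ N := by exact_mod_cast hk
    have h2 := mul_le_mul_of_nonneg_right h1 (by positivity : 0 ≤ C * (1 + m) * h)
    linarith
  exact (mul_le_mul hgrowth hinitle (integral_nonneg fun ω => by positivity)
    (by positivity)).trans_eq (mul_assoc _ _ _).symm
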